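/- Consider the Hegselmann--Krause dynamics in dimension one with a set $N=\{1,\dots,n\}$ of non-strategic agents and a finite set $S$ of $m$ strategic agents, $A=N\cup S$. The opinions $x_s(t)\in\mathbb{R}$, $s\in S$, $t\in\mathbb{N}_{\ge 0}$, can be chosen freely, and for $i\in N$ $$x_i(t+1)=\frac{\sum_{j\in A:\,|x_i(t)-x_j(t)|\le 1}x_j(t)}{\left|\{j\in A:\,|x_i(t)-x_j(t)|\le 1\}\right|}.$$ The system has converged at time $t$ if for all $i,j\in N$ either $x_i(t)=x_j(t)$ or $|x_i(t)-x_j(t)|>1$; the convergence time is the smallest such $t$. The optimal convergence time, for given starting opinions of the non-strategic agents and given $m$, is the minimum of the convergence time over all choices of the opinions of the $m$ strategic agents. Lemma. For $n\in\mathbb{N}_{>0}$ consider the equidistant configuration $x_i(0)=i-1$, $1\le i\le n$. Its convergence time without strategic agents is finite and in $\Omega(n)$ as $n\to\infty$ (i.e. at least $c\,n$ for some constant $c>0$ and all sufficiently large $n$), while its optimal convergence time for $m=1$ strategic agent is finite and in $O(n^{3/4})$ as $n\to\infty$. -/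

import Mathlib

open Filter Asymptotics

namespace HK

variable {N S : Type*} [Fintype N] [Fintype S]

/-- The agents that influence agent `i` when the opinions of all agents are given by `z`:
those whose opinion is at distance at most `1` from the opinion of `i` (including `i`). -/
noncomputable def neighbors {A : Type*} [Fintype A] (z : A → ℝ) (i : A) : Finset A :=
  Finset.univ.filter fun j => |z i - z j| ≤ 1

/-- One step of the Hegselmann--Krause dynamics. `x` holds the opinions of the non-strategic
agents `N`, `u` those of the strategic agents `S`; the set of all agents is `N ⊕ S`. The new
opinion of a non-strategic agent is the mean of all opinions that influence it. -/
noncomputable def step (x : N → ℝ) (u : S → ℝ) (i : N) : ℝ :=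
  (∑ j ∈ neighbors (Sum.elim x u) (Sum.inl i), Sum.elim x u j) /
    ((neighbors (Sum.elim x u) (Sum.inl i)).card : ℝ)

/-- Opinions of the non-strategic agents at each time, for starting opinions `x₀`, where `u t s`
is the freely chosen opinion of the strategic agent `s` at time `t`. -/
noncomputable def opinions (x₀ : N → ℝ) (u : ℕ → S → ℝ) : ℕ → N → ℝ
  | 0 => x₀
  | t + 1 => step (opinions x₀ u t) (u t)

/-- All non-strategic agents are frozen: any two of them either have the same opinion or are
not neighbors. -/
def Converged {N : Type*} (x : N → ℝ) : Prop :=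
  ∀ i j : N, x i = x j ∨ 1 < |x i - x j|

/-- The smallest time at which the system has converged (`⊤` if there is none). -/
noncomputable def convergenceTime (x₀ : N → ℝ) (u : ℕ → S → ℝ) : ℕ∞ :=
  ⨅ (t : ℕ) (_ : Converged (opinions x₀ u t)), (t : ℕ∞)

/-- The convergence time without strategic agents. -/
noncomputable def uncontrolledConvergenceTime (x₀ : N → ℝ) : ℕ∞ :=
  convergenceTime x₀ fun (_ : ℕ) (s : Fin 0) => s.elim0

/-- The least convergence time over all choices of the opinions of `m` strategic agents. -/
noncomputable def optimalConvergenceTime (x₀ : N → ℝ) (m : ℕ) : ℕ∞ :=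
  ⨅ u : ℕ → Fin m → ℝ, convergenceTime x₀ u

/-- The equidistant configuration `0, 1, …, n - 1`: with agents numbered from `1` to `n`,
agent `i` has opinion `i - 1`. -/
def equidistant (n : ℕ) (i : Fin n) : ℝ := ((i : ℕ) : ℝ)

end HK

namespace HK

variable {N S : Type*} [Fintype N] [Fintype S] {n : ℕ}

/-! Lower bound: an agent whose neighbors sit symmetrically around it does not move, so without
control the disturbance enters from each end by one agent per step. For `t < n / 2` two adjacent
agents at distance exactly 1 remain (`undisturbed_opinions`).

Upper bound: a strategic agent halfway between the undisturbed agents `p` and `p + 1` pulls both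
inwards while their outer neighbors stay put, so one step cuts the chain (`Undisturbed.isCut_step`).
A gap persists while its two border agents see no strategic agent. About `n / W` cuts, made
alternately from the left and from the right, leave blocks of `O(W)` agents; then the strategic
agent retires out of sight and the blocks evolve independently. A block of `L` agents freezes in
`O(L ^ 3)` steps, so `W ≈ n ^ (1/4)` balances `n / W` against `W ^ 3`.

The cubic bound (`frozenOn_of_spread_le`), which also gives finiteness without control, uses the
spread of a block as potential. Within two steps either the bottom agent rises by `1 / (2 L ^ 2)`,
or a clique at the bottom separates, merges in one step, and leaves a block with spread smaller by
at least 1. -/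

/-! ### Comparing the mean with a threshold; preservation of order -/

theorem self_mem_neighbors {A : Type*} [Fintype A] (z : A → ℝ) (i : A) : i ∈ neighbors z i := by
  simp [neighbors]

theorem mem_neighbors {A : Type*} [Fintype A] {z : A → ℝ} {i j : A} :
    j ∈ neighbors z i ↔ |z i - z j| ≤ 1 := by
  simp [neighbors]

theorem card_neighbors_pos {A : Type*} [Fintype A] (z : A → ℝ) (i : A) :
    (0 : ℝ) < (neighbors z i).card :=
  Nat.cast_pos.2 (Finset.card_pos.2 ⟨i, self_mem_neighbors z i⟩)

/-- Reduces every bound on a new opinion to the sign of a sum of deviations, with no division by the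
number of neighbors. -/
theorem card_mul_step_sub (x : N → ℝ) (u : S → ℝ) (i : N) (c : ℝ) :
    ((neighbors (Sum.elim x u) (Sum.inl i)).card : ℝ) * (step x u i - c) =
      ∑ j ∈ neighbors (Sum.elim x u) (Sum.inl i), (Sum.elim x u j - c) := by
  have h := (card_neighbors_pos (Sum.elim x u) (Sum.inl i)).ne'
  rw [Finset.sum_sub_distrib, Finset.sum_const, nsmul_eq_mul, mul_sub, step, mul_div_cancel₀ _ h]

theorem step_le_of_sum_nonpos {x : N → ℝ} {u : S → ℝ} {i : N} {c : ℝ}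
    (h : ∑ j ∈ neighbors (Sum.elim x u) (Sum.inl i), (Sum.elim x u j - c) ≤ 0) :
    step x u i ≤ c := by
  rw [← card_mul_step_sub] at h
  have := card_neighbors_pos (Sum.elim x u) (Sum.inl i)
  by_contra! hc
  exact absurd h (not_le.2 (mul_pos this (sub_pos.2 hc)))

theorem le_step_of_sum_nonneg {x : N → ℝ} {u : S → ℝ} {i : N} {c : ℝ}
    (h : 0 ≤ ∑ j ∈ neighbors (Sum.elim x u) (Sum.inl i), (Sum.elim x u j - c)) :
    c ≤ step x u i := by
  rw [← card_mul_step_sub] at h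
  have := card_neighbors_pos (Sum.elim x u) (Sum.inl i)
  by_contra! hc
  exact absurd h (not_le.2 (mul_neg_of_pos_of_neg this (sub_neg.2 hc)))

theorem step_lt_of_sum_neg {x : N → ℝ} {u : S → ℝ} {i : N} {c : ℝ}
    (h : ∑ j ∈ neighbors (Sum.elim x u) (Sum.inl i), (Sum.elim x u j - c) < 0) :
    step x u i < c := by
  rw [← card_mul_step_sub] at h
  have := card_neighbors_pos (Sum.elim x u) (Sum.inl i)
  by_contra! hc
  exact absurd h (not_lt.2 (mul_nonneg this.le (sub_nonneg.2 hc)))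

theorem lt_step_of_sum_pos {x : N → ℝ} {u : S → ℝ} {i : N} {c : ℝ}
    (h : 0 < ∑ j ∈ neighbors (Sum.elim x u) (Sum.inl i), (Sum.elim x u j - c)) :
    c < step x u i := by
  rw [← card_mul_step_sub] at h
  have := card_neighbors_pos (Sum.elim x u) (Sum.inl i)
  by_contra! hc
  exact absurd h (not_lt.2 (mul_nonpos_of_nonneg_of_nonpos this.le (sub_nonpos.2 hc)))

/-- The dynamics preserves the order of the opinions. -/
theorem step_mono (x : N → ℝ) (u : S → ℝ) {i j : N} (hij : x i ≤ x j) :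
    step x u i ≤ step x u j := by
  classical
  set z := Sum.elim x u with hz
  set P := neighbors z (Sum.inl i) with hP
  set Q := neighbors z (Sum.inl j) with hQ
  have zi : z (Sum.inl i) = x i := rfl
  have zj : z (Sum.inl j) = x j := rfl
  -- The separating threshold is the mean of the common neighbors, or `x j - 1` if there are none:
  -- those seen only by `i` lie below it, those seen only by `j` above it.
  obtain ⟨c, hc, hcP, hcQ⟩ : ∃ c : ℝ, ∑ k ∈ P ∩ Q, (z k - c) = 0 ∧
      (∀ k ∈ P \ Q, z k ≤ c) ∧ ∀ k ∈ Q \ P, c ≤ z k := by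
    have hPQ : ∀ k ∈ P \ Q, z k ≤ x j - 1 := by
      intro k hk
      simp only [Finset.mem_sdiff, hP, hQ, mem_neighbors, zi, zj, abs_le, not_and_or, not_le] at hk
      obtain ⟨⟨h1, h2⟩, h | h⟩ := hk <;> linarith
    have hQP : ∀ k ∈ Q \ P, x i + 1 ≤ z k := by
      intro k hk
      simp only [Finset.mem_sdiff, hP, hQ, mem_neighbors, zi, zj, abs_le, not_and_or, not_le] at hk
      obtain ⟨⟨h1, h2⟩, h | h⟩ := hk <;> linarith
    rcases (P ∩ Q).eq_empty_or_nonempty with he | hne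
    · refine ⟨x j - 1, by simp [he], hPQ, fun k hk => ?_⟩
      have := (Finset.mem_sdiff.1 hk).1
      rw [hQ, mem_neighbors, zj, abs_le] at this
      linarith [this.2]
    · have hpos : (0 : ℝ) < (P ∩ Q).card := Nat.cast_pos.2 (Finset.card_pos.2 hne)
      have hmem : ∀ k ∈ P ∩ Q, x j - 1 ≤ z k ∧ z k ≤ x i + 1 := by
        intro k hk
        simp only [Finset.mem_inter, hP, hQ, mem_neighbors, zi, zj, abs_le] at hk
        constructor <;> linarith [hk.1.1, hk.2.2]
      refine ⟨(∑ k ∈ P ∩ Q, z k) / (P ∩ Q).card, ?_, fun k hk => (hPQ k hk).trans ?_,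
        fun k hk => le_trans ?_ (hQP k hk)⟩
      · rw [Finset.sum_sub_distrib, Finset.sum_const, nsmul_eq_mul, mul_div_cancel₀ _ hpos.ne',
          sub_self]
      · rw [le_div_iff₀ hpos, mul_comm, ← nsmul_eq_mul]
        exact Finset.card_nsmul_le_sum _ _ _ fun k hk => (hmem k hk).1
      · rw [div_le_iff₀ hpos, mul_comm, ← nsmul_eq_mul]
        exact Finset.sum_le_card_nsmul _ _ _ fun k hk => (hmem k hk).2
  have h1 : step x u i ≤ c := by
    apply step_le_of_sum_nonpos
    rw [← hz, ← hP, ← Finset.sum_inter_add_sum_sdiff P Q, hc, zero_add]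
    exact Finset.sum_nonpos fun k hk => sub_nonpos.2 (hcP k hk)
  have h2 : c ≤ step x u j := by
    apply le_step_of_sum_nonneg
    rw [← hz, ← hQ, ← Finset.sum_inter_add_sum_sdiff Q P, Finset.inter_comm, hc, zero_add]
    exact Finset.sum_nonneg fun k hk => sub_nonneg.2 (hcQ k hk)
  exact h1.trans h2

theorem step_congr (x : N → ℝ) (u : S → ℝ) {i j : N} (h : x i = x j) :
    step x u i = step x u j :=
  le_antisymm (step_mono x u h.le) (step_mono x u h.ge)

theorem monotone_step {x : Fin n → ℝ} (u : S → ℝ) (hx : Monotone x) : Monotone (step x u) :=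
  fun _ _ hij => step_mono x u (hx hij)

theorem monotone_opinions {x : Fin n → ℝ} (u : ℕ → S → ℝ) (hx : Monotone x) :
    ∀ t, Monotone (opinions x u t)
  | 0 => hx
  | t + 1 => monotone_step (u t) (monotone_opinions u hx t)

theorem mem_neighbors_of_far {x : N → ℝ} {u : S → ℝ} {i : N} (hf : ∀ s, 1 < |x i - u s|)
    {j : N ⊕ S} (hj : j ∈ neighbors (Sum.elim x u) (Sum.inl i)) :
    ∃ k, j = Sum.inl k ∧ |x i - x k| ≤ 1 := by
  rw [mem_neighbors] at hj
  rcases j with k | s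
  · exact ⟨k, rfl, hj⟩
  · exact absurd hj (not_le.2 (hf s))

theorem step_le_of_far {x : N → ℝ} {u : S → ℝ} {i : N} {c : ℝ} (hf : ∀ s, 1 < |x i - u s|)
    (h : ∀ k, |x i - x k| ≤ 1 → x k ≤ c) : step x u i ≤ c := by
  refine step_le_of_sum_nonpos (Finset.sum_nonpos fun j hj => ?_)
  obtain ⟨k, rfl, hk⟩ := mem_neighbors_of_far hf hj
  exact sub_nonpos.2 (h k hk)

theorem le_step_of_far {x : N → ℝ} {u : S → ℝ} {i : N} {c : ℝ} (hf : ∀ s, 1 < |x i - u s|)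
    (h : ∀ k, |x i - x k| ≤ 1 → c ≤ x k) : c ≤ step x u i := by
  refine le_step_of_sum_nonneg (Finset.sum_nonneg fun j hj => ?_)
  obtain ⟨k, rfl, hk⟩ := mem_neighbors_of_far hf hj
  exact sub_nonneg.2 (h k hk)

/-! ### Gaps and the blocks between them -/

/-- Every agent with index less than `c` is at distance more than `1` below every agent with
index at least `c`. -/
def IsGap (x : Fin n → ℝ) (c : ℕ) : Prop :=
  ∀ i j : Fin n, i.val < c → c ≤ j.val → 1 < x j - x i

theorem isGap_zero (x : Fin n → ℝ) : IsGap x 0 := fun _ _ h => absurd h (Nat.not_lt_zero _)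

theorem isGap_self (x : Fin n → ℝ) : IsGap x n := fun _ j _ h => absurd j.2 (not_lt.2 h)

/-- By preservation of order only the last agent before the gap matters, and it averages over agents
on its own side. -/
theorem step_le_of_isGap {x : Fin n → ℝ} {u : S → ℝ} {c : ℕ} (hcn : c ≤ n)
    (hx : Monotone x) (hc : IsGap x c) (hf : ∀ i : Fin n, i.val + 1 = c → ∀ s, 1 < |x i - u s|) {B : ℝ}
    (hB : ∀ k : Fin n, k.val < c → x k ≤ B) {i : Fin n} (hi : i.val < c) : step x u i ≤ B := by
  set m : Fin n := ⟨c - 1, by omega⟩ with hm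
  have him : i ≤ m := by rw [Fin.le_def]; simp only [hm]; omega
  refine (monotone_step u hx him).trans (step_le_of_far (hf m (by simp only [hm]; omega)) ?_)
  intro k hk
  refine hB k ?_
  by_contra! hck
  have := hc m k (by simp only [hm]; omega) hck
  linarith [neg_le_abs (x m - x k)]

theorem le_step_of_isGap {x : Fin n → ℝ} {u : S → ℝ} {c : ℕ} (hx : Monotone x) (hc : IsGap x c)
    (hf : ∀ i : Fin n, i.val = c → ∀ s, 1 < |x i - u s|) {B : ℝ}
    (hB : ∀ k : Fin n, c ≤ k.val → B ≤ x k) {i : Fin n} (hi : c ≤ i.val) : B ≤ step x u i := by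
  set m : Fin n := ⟨c, by omega⟩ with hm
  have him : m ≤ i := by rw [Fin.le_def]; exact hi
  refine le_trans (le_step_of_far (hf m rfl) ?_) (monotone_step u hx him)
  intro k hk
  refine hB k ?_
  by_contra! hck
  have := hc k m hck le_rfl
  linarith [le_abs_self (x m - x k)]

theorem IsGap.step {x : Fin n → ℝ} {u : S → ℝ} {c : ℕ} (hx : Monotone x) (hc : IsGap x c)
    (hf : ∀ i : Fin n, i.val + 1 = c ∨ i.val = c → ∀ s, 1 < |x i - u s|) :
    IsGap (step x u) c := by
  intro i j hi hj
  have h1 := step_le_of_isGap (by omega) hx hc (fun k hk => hf k (.inl hk)) (B := x ⟨c - 1, by omega⟩)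
    (fun k hk => hx (by rw [Fin.le_def]; simp only; omega)) hi
  have h2 := le_step_of_isGap hx hc (fun k hk => hf k (.inr hk)) (B := x ⟨c, by omega⟩)
    (fun k hk => hx (by rw [Fin.le_def]; simpa using hk)) hj
  have := hc ⟨c - 1, by omega⟩ ⟨c, by omega⟩ (by simp only; omega) le_rfl
  linarith

/-- Any two agents of the block `[a, b)` have equal opinions or are not neighbors. -/
def FrozenOn (x : Fin n → ℝ) (a b : ℕ) : Prop :=
  ∀ i j : Fin n, a ≤ i.val → i.val < b → a ≤ j.val → j.val < b → x i = x j ∨ 1 < |x i - x j|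

theorem FrozenOn.append {x : Fin n → ℝ} {a b c : ℕ} (h₁ : FrozenOn x a b) (h₂ : FrozenOn x b c)
    (hb : IsGap x b) : FrozenOn x a c := by
  intro i j hai hic haj hjc
  rcases lt_or_ge i.val b with hi | hi <;> rcases lt_or_ge j.val b with hj | hj
  · exact h₁ i j hai hi haj hj
  · exact .inr ((hb i j hi hj).trans_le (by linarith [neg_le_abs (x i - x j)]))
  · exact .inr ((hb j i hj hi).trans_le (by linarith [le_abs_self (x i - x j)]))
  · exact h₂ i j hi hic hj hjc

theorem mem_block_of_abs_sub_le_one {x : Fin n → ℝ} {a b : ℕ} (ha : IsGap x a) (hb : IsGap x b)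
    {i k : Fin n} (hai : a ≤ i.val) (hib : i.val < b) (hk : |x i - x k| ≤ 1) :
    a ≤ k.val ∧ k.val < b := by
  rw [abs_le] at hk
  constructor
  · by_contra! h
    linarith [ha k i h hai]
  · by_contra! h
    linarith [hb i k hib h]

theorem card_neighbors_le {x : Fin n → ℝ} {u : S → ℝ} {a b : ℕ} (ha : IsGap x a) (hb : IsGap x b)
    {i : Fin n} (hf : ∀ s, 1 < |x i - u s|) (hai : a ≤ i.val) (hib : i.val < b) :
    (neighbors (Sum.elim x u) (Sum.inl i)).card ≤ b - a := by
  rw [← Nat.card_Ico]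
  refine Finset.card_le_card_of_injOn (Sum.elim (fun k : Fin n => k.val) fun _ => 0) ?_ ?_
  · intro j hj
    obtain ⟨k, rfl, hk⟩ := mem_neighbors_of_far hf hj
    simpa using mem_block_of_abs_sub_le_one ha hb hai hib hk
  · intro j hj j' hj' h
    obtain ⟨k, rfl, -⟩ := mem_neighbors_of_far hf hj
    obtain ⟨k', rfl, -⟩ := mem_neighbors_of_far hf hj'
    exact congrArg _ (Fin.ext h)

/-! ### Freezing time of a block -/

/-- An agent of a block of at most `L` agents with opinions at least `c` that has a neighbor with
opinion at least `c + d` moves to at least `c + d / L`. -/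
theorem add_div_le_step {x : Fin n → ℝ} {u : S → ℝ} {a b L : ℕ} (ha : IsGap x a)
    (hb : IsGap x b) (hL : b - a ≤ L) {i j : Fin n} (hf : ∀ s, 1 < |x i - u s|)
    (hai : a ≤ i.val) (hib : i.val < b) (hij : |x i - x j| ≤ 1) {c d : ℝ} (hd : 0 ≤ d)
    (hc : ∀ k : Fin n, a ≤ k.val → k.val < b → c ≤ x k) (hj : c + d ≤ x j) :
    c + d / L ≤ step x u i := by
  have hcard := card_neighbors_le ha hb hf hai hib
  have hpos := card_neighbors_pos (Sum.elim x u) (Sum.inl i)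
  have hsum := card_mul_step_sub x u i c
  have hmem : (Sum.inl j : Fin n ⊕ S) ∈ neighbors (Sum.elim x u) (Sum.inl i) :=
    mem_neighbors.2 hij
  have hle : d ≤ ∑ k ∈ neighbors (Sum.elim x u) (Sum.inl i), (Sum.elim x u k - c) := by
    refine le_trans ?_ (Finset.single_le_sum (fun k hk => ?_) hmem)
    · simp only [Sum.elim_inl]; linarith
    · obtain ⟨k, rfl, hk'⟩ := mem_neighbors_of_far hf hk
      obtain ⟨h1, h2⟩ := mem_block_of_abs_sub_le_one ha hb hai hib hk'
      exact sub_nonneg.2 (hc k h1 h2)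
  rw [← hsum] at hle
  have hLR : ((neighbors (Sum.elim x u) (Sum.inl i)).card : ℝ) ≤ L := by
    exact_mod_cast hcard.trans hL
  have : d / L ≤ step x u i - c := by
    calc d / L ≤ d / (neighbors (Sum.elim x u) (Sum.inl i)).card :=
          div_le_div_of_nonneg_left hd hpos hLR
      _ ≤ _ := by rw [div_le_iff₀ hpos, mul_comm]; exact hle
  linarith

/-- An agent of a block of at most `L` agents that is at most `1 / L` above an agent `i₀` moves to at
most `1` above the previous opinion of `i₀`. -/
theorem step_le_add_one {x : Fin n → ℝ} {u : S → ℝ} {a b L : ℕ} (ha : IsGap x a)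
    (hb : IsGap x b) (hL : b - a ≤ L) {i i₀ : Fin n} (hf : ∀ s, 1 < |x i - u s|)
    (hai : a ≤ i.val) (hib : i.val < b) (hi₀ : x i₀ ≤ x i) (hi : x i ≤ x i₀ + 1 / L) :
    step x u i ≤ x i₀ + 1 := by
  classical
  have hcard := card_neighbors_le ha hb hf hai hib
  have hLpos : (1 : ℝ) ≤ L := by
    have : 1 ≤ L := by omega
    exact_mod_cast this
  have hLinv : 1 / (L : ℝ) ≤ 1 := by rw [div_le_one (by linarith)]; exact hLpos
  have hmem : (Sum.inl i₀ : Fin n ⊕ S) ∈ neighbors (Sum.elim x u) (Sum.inl i) := by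
    refine mem_neighbors.2 (abs_le.2 ⟨?_, ?_⟩) <;> simp only [Sum.elim_inl] <;> linarith
  apply step_le_of_sum_nonpos
  -- The term of `i₀` is `-1`; each of the fewer than `L` others is at most `1 / L`.
  rw [← Finset.add_sum_erase _ _ hmem]
  have h1 : ∑ k ∈ (neighbors (Sum.elim x u) (Sum.inl i)).erase (Sum.inl i₀),
      (Sum.elim x u k - (x i₀ + 1)) ≤
      ((neighbors (Sum.elim x u) (Sum.inl i)).erase (Sum.inl i₀)).card • (1 / (L : ℝ)) := by
    refine Finset.sum_le_card_nsmul _ _ _ fun k hk => ?_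
    obtain ⟨k, rfl, hk'⟩ := mem_neighbors_of_far hf (Finset.mem_of_mem_erase hk)
    simp only [Sum.elim_inl]
    linarith [(abs_le.1 hk').1]
  have h2 : (((neighbors (Sum.elim x u) (Sum.inl i)).erase (Sum.inl i₀)).card : ℝ) ≤ L := by
    exact_mod_cast (Finset.card_le_card (Finset.erase_subset _ _)).trans (hcard.trans hL)
  have h3 : (((neighbors (Sum.elim x u) (Sum.inl i)).erase (Sum.inl i₀)).card : ℝ) * (1 / L) ≤ 1 := by
    rw [mul_one_div, div_le_one (by linarith)]; exact h2
  rw [nsmul_eq_mul] at h1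
  simp only [Sum.elim_inl]
  linarith

theorem isGap_of_le {x : ℕ → Fin n → ℝ} {u : ℕ → S → ℝ}
    (hx : ∀ t, x (t + 1) = step (x t) (u t)) (hm : ∀ t, Monotone (x t))
    (hf : ∀ t i s, 1 < |x t i - u t s|) {c t t' : ℕ} (hc : IsGap (x t) c) (htt : t ≤ t') :
    IsGap (x t') c := by
  induction t', htt using Nat.le_induction with
  | base => exact hc
  | succ t' _ ih => rw [hx]; exact ih.step (hm t') fun i _ => hf t' i

theorem eq_of_le {x : ℕ → Fin n → ℝ} {u : ℕ → S → ℝ}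
    (hx : ∀ t, x (t + 1) = step (x t) (u t)) {i j : Fin n} {t t' : ℕ}
    (h : x t i = x t j) (htt : t ≤ t') : x t' i = x t' j := by
  induction t', htt using Nat.le_induction with
  | base => exact h
  | succ t' _ ih => rw [hx]; exact step_congr _ _ ih

/-- In a block all of whose agents are neighbors of each other, all opinions agree after one
step. -/
theorem step_eq_step_of_clique {x : Fin n → ℝ} {u : S → ℝ} {a b : ℕ} (ha : IsGap x a)
    (hb : IsGap x b) (hf : ∀ i s, 1 < |x i - u s|)
    (hclique : ∀ i j : Fin n, a ≤ i.val → i.val < b → a ≤ j.val → j.val < b → x j ≤ x i + 1)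
    {i j : Fin n} (hai : a ≤ i.val) (hib : i.val < b) (haj : a ≤ j.val) (hjb : j.val < b) :
    step x u i = step x u j := by
  have key : ∀ i : Fin n, a ≤ i.val → i.val < b → ∀ k : Fin n ⊕ S,
      k ∈ neighbors (Sum.elim x u) (Sum.inl i) ↔ ∃ l : Fin n, k = .inl l ∧ a ≤ l.val ∧ l.val < b := by
    intro i hai hib k
    constructor
    · intro hk
      obtain ⟨l, rfl, hl⟩ := mem_neighbors_of_far (hf i) hk
      exact ⟨l, rfl, mem_block_of_abs_sub_le_one ha hb hai hib hl⟩
    · rintro ⟨l, rfl, hal, hlb⟩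
      refine mem_neighbors.2 (abs_le.2 ⟨?_, ?_⟩) <;> simp only [Sum.elim_inl]
      · linarith [hclique i l hai hib hal hlb]
      · linarith [hclique l i hal hlb hai hib]
  have : neighbors (Sum.elim x u) (Sum.inl i) = neighbors (Sum.elim x u) (Sum.inl j) := by
    ext k
    rw [key i hai hib, key j haj hjb]
  rw [step, step, this]

/-- A block of at most `L` agents whose opinions spread over at most `k / (2 L ^ 2)` is frozen
after `2 k + 1` steps. -/
theorem frozenOn_of_spread_le {x : ℕ → Fin n → ℝ} {u : ℕ → S → ℝ}
    (hx : ∀ t, x (t + 1) = step (x t) (u t)) (hm : ∀ t, Monotone (x t))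
    (hf : ∀ t i s, 1 < |x t i - u t s|) {L : ℕ} (hL : 0 < L) (k : ℕ) :
    ∀ a b t : ℕ, b ≤ n → b - a ≤ L → IsGap (x t) a → IsGap (x t) b →
      (∀ i j : Fin n, a ≤ i.val → i.val < b → a ≤ j.val → j.val < b →
        x t j ≤ x t i + k * (1 / (2 * (L : ℝ) ^ 2))) →
      ∀ t', t + 2 * k + 1 ≤ t' → FrozenOn (x t') a b := by
  have hL1 : (1 : ℝ) ≤ L := by exact_mod_cast hL
  have hη : 1 / (2 * (L : ℝ) ^ 2) = 1 / (2 * L) / L := by field_simp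
  have hη2 : 1 / (2 * (L : ℝ)) / L ≤ 1 / (2 * L) := div_le_self (by positivity) hL1
  have hη3 : 1 / (2 * (L : ℝ)) ≤ 1 / L := by
    apply one_div_le_one_div_of_le <;> linarith
  have hη4 : 1 / (L : ℝ) ≤ 1 := by rw [div_le_one (by linarith)]; exact hL1
  rw [hη]
  set η := 1 / (2 * (L : ℝ)) / L with hηdef
  have hη0 : 0 < η := by positivity
  induction k with
  | zero =>
    intro a b t _ _ _ _ hsp t' ht' i j hai hib haj hjb
    refine .inl (eq_of_le hx (le_antisymm ?_ ?_) (by omega : t ≤ t'))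
    · simpa using hsp j i haj hjb hai hib
    · simpa using hsp i j hai hib haj hjb
  | succ k ih =>
    intro a b t hbn hbL ha hb hsp t' ht'
    rcases le_or_gt b a with hba | hab
    · intro i j hai hib; omega
    have hsp' : ∀ i j : Fin n, a ≤ i.val → i.val < b → a ≤ j.val → j.val < b →
        x t j ≤ x t i + k * η + η := by
      intro i j h1 h2 h3 h4
      have := hsp i j h1 h2 h3 h4
      push_cast at this
      linarith
    set α : Fin n := ⟨a, by omega⟩ with hα
    have hαle : ∀ s, ∀ i : Fin n, a ≤ i.val → x s α ≤ x s i := fun s i hi => hm s hi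
    have hga : ∀ s, t ≤ s → IsGap (x s) a := fun s hs => isGap_of_le hx hm hf ha hs
    have hgb : ∀ s, t ≤ s → IsGap (x s) b := fun s hs => isGap_of_le hx hm hf hb hs
    have hup : ∀ s, t ≤ s → ∀ B : ℝ, (∀ k : Fin n, k.val < b → x s k ≤ B) →
        ∀ k : Fin n, k.val < b → x (s + 1) k ≤ B := by
      intro s hs B hB k hk
      rw [hx]
      exact step_le_of_isGap hbn (hm s) (hgb s hs) (fun i _ => hf s i) hB hk
    have hαmono : ∀ s, t ≤ s → x s α ≤ x (s + 1) α := by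
      intro s hs
      rw [hx]
      exact le_step_of_isGap (hm s) (hga s hs) (fun i _ => hf s i) (hαle s) le_rfl
    have hB0 : ∀ k : Fin n, k.val < b → x t k ≤ x t ⟨b - 1, by omega⟩ := fun k hk =>
      hm t (by rw [Fin.le_def]; simp only; omega)
    have hB1 := hup t le_rfl _ hB0
    have hB2 := hup (t + 1) (by omega) _ hB1
    have htop : x t ⟨b - 1, by omega⟩ ≤ x t α + k * η + η :=
      hsp' α _ le_rfl hab (by simp only; omega) (by simp only; omega)
    -- progress of the bottom agent within two steps suffices
    have hprog : ∀ s, t ≤ s → s ≤ t + 2 → (∀ k : Fin n, k.val < b → x s k ≤ x t ⟨b - 1, by omega⟩) →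
        x t α + η ≤ x s α → FrozenOn (x t') a b := by
      intro s hs hs2 hBs hαs
      refine ih a b s hbn hbL (hga s hs) (hgb s hs) ?_ t' (by omega)
      intro i j hai hib haj hjb
      have := hαle s i hai
      have := hBs j hjb
      linarith
    -- Case 1: the bottom agent has a neighbor at least `1 / L` above it, so it rises by `1 / L ^ 2`
    -- at once.
    by_cases hA : ∃ j : Fin n, a ≤ j.val ∧ j.val < b ∧ x t α + 1 / L ≤ x t j ∧ x t j ≤ x t α + 1
    · obtain ⟨j, haj, hjb, hj1, hj2⟩ := hA
      refine hprog (t + 1) (by omega) (by omega) hB1 ?_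
      have := add_div_le_step ha hb hbL (i := α) (j := j) (hf t α) le_rfl hab
        (abs_le.2 ⟨by linarith, by linarith [hαle t j haj]⟩) (by positivity)
        (fun k hk _ => hαle t k hk) hj1
      rw [hx]
      have h2 : η ≤ 1 / (L : ℝ) / L := by
        rw [hηdef]; gcongr
      linarith
    push Not at hA
    -- Otherwise every neighbor of the bottom agent within the block is less than `1 / L` above it.
    -- Let `c` be the first index from which on the block is out of its sight.
    have hex : ∃ c, a ≤ c ∧ ∀ j : Fin n, c ≤ j.val → j.val < b → x t α + 1 < x t j :=
      ⟨b, hab.le, fun j h1 h2 => by omega⟩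
    classical
    obtain ⟨hac, hcj⟩ := Nat.find_spec hex
    have hmin := fun c' => Nat.find_min hex (m := c')
    set c := Nat.find hex with hc
    have hcb : c ≤ b := by
      rw [hc]; exact Nat.find_min' hex ⟨hab.le, fun j h1 h2 => by omega⟩
    have hlow : ∀ i : Fin n, a ≤ i.val → i.val < c → x t i ≤ x t α + 1 := by
      intro i hai hic
      have := hmin i hic
      push Not at this
      obtain ⟨j, hij, _, hj⟩ := this hai
      exact (hm t hij).trans hj
    -- Case 2: the agents below `c` form an isolated clique and merge; the rest starts more than 1
    -- above the bottom, so it has lost at least one unit `η` of spread.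
    by_cases hgc : IsGap (x t) c
    · refine FrozenOn.append (b := c) ?_ ?_ (isGap_of_le hx hm hf hgc (by omega))
      · intro i j hai hic haj hjc
        refine .inl (eq_of_le hx (t := t + 1) ?_ (by omega))
        rw [hx]
        exact step_eq_step_of_clique ha hgc (hf t) (fun i j hai hic haj hjc =>
          (hlow j haj hjc).trans (by linarith [hαle t i hai])) hai hic haj hjc
      · refine ih c b t hbn (by omega) hgc hb ?_ t' (by omega)
        intro i j hci hib _ hjb
        have := hcj i hci hib
        have := hB0 j hjb
        linarith
    -- Case 3: some `i` below `c` sees a `j` beyond it. Then `i` rises to at least `1 / L` above the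
    -- old bottom, but to at most 1 above it, so the bottom agent still sees it.
    · rw [IsGap] at hgc
      push Not at hgc
      obtain ⟨i, j, hic, hcj', hij⟩ := hgc
      have hij0 : x t i ≤ x t j := hm t (by rw [Fin.le_def]; omega)
      have hjb : j.val < b := by
        by_contra! h
        linarith [hb i j (by omega) h]
      have hai : a ≤ i.val := by
        by_contra! h
        linarith [ha i j h (by omega)]
      have hj := hcj j hcj' hjb
      have hi : x t i ≤ x t α + 1 / L := by
        by_contra! h
        linarith [hA i hai (by omega) h.le, hlow i hai hic]
      have h1 := add_div_le_step (c := x t α) (d := 1) ha hb hbL (i := i) (j := j) (hf t i) hai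
        (by omega) (abs_le.2 ⟨by linarith, by linarith⟩) (by positivity)
        (fun k hk _ => hαle t k hk) (by linarith)
      have h2 := step_le_add_one ha hb hbL (hf t i) hai (by omega) (hαle t i hai) hi
      rw [← hx] at h1 h2
      have hα1 := hαmono t le_rfl
      -- Either the bottom agent has already risen by `1 / (2 L) ≥ η`, or `i` is still `1 / (2 L)`
      -- above it and lifts it by `η` in the second step.
      by_cases hfast : x t α + 1 / (2 * L) ≤ x (t + 1) α
      · exact hprog (t + 1) (by omega) (by omega) hB1 (by linarith)
      · push Not at hfast
        refine hprog (t + 2) (by omega) le_rfl hB2 ?_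
        have hhalf : 1 / (L : ℝ) = 1 / (2 * L) + 1 / (2 * L) := by field_simp; norm_num
        have h3 := add_div_le_step (c := x (t + 1) α) (d := 1 / (2 * L)) (hga (t + 1) (by omega))
          (hgb (t + 1) (by omega)) hbL (i := α) (j := i) (hf (t + 1) α) le_rfl hab
          (abs_le.2 ⟨by linarith, by linarith [hαle (t + 1) i hai]⟩) (by positivity)
          (fun k hk _ => hαle (t + 1) k hk) (by linarith)
        rw [← hx] at h3
        linarith

/-! ### The undisturbed part of the chain -/

/-- The agents of `[lo, hi]` are at their equidistant positions, and all other agents are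
strictly to their left or right. -/
structure Undisturbed (x : Fin n → ℝ) (lo hi : ℕ) : Prop where
  eq : ∀ i : Fin n, lo ≤ i.val → i.val ≤ hi → x i = (i.val : ℝ)
  lt : ∀ i : Fin n, i.val < lo → x i < lo
  gt : ∀ i : Fin n, hi < i.val → (hi : ℝ) < x i

theorem Undisturbed.mono {x : Fin n → ℝ} {lo hi lo' hi' : ℕ} (h : Undisturbed x lo hi)
    (hlo : lo ≤ lo') (hhi : hi' ≤ hi) (hle : lo' ≤ hi') : Undisturbed x lo' hi' where
  eq i h1 h2 := h.eq i (by omega) (by omega)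
  lt i hlt := by
    rcases lt_or_ge i.val lo with h1 | h1
    · exact (h.lt i h1).trans_le (by exact_mod_cast hlo)
    · rw [h.eq i h1 (by omega)]; exact_mod_cast hlt
  gt i hgt := by
    rcases lt_or_ge hi i.val with h1 | h1
    · exact lt_of_le_of_lt (by exact_mod_cast hhi) (h.gt i h1)
    · rw [h.eq i (by omega) h1]; exact_mod_cast hgt

theorem undisturbed_equidistant {lo hi : ℕ} : Undisturbed (equidistant n) lo hi where
  eq _ _ _ := rfl
  lt i h := by simpa [equidistant] using h
  gt i h := by simpa [equidistant] using h

theorem monotone_equidistant : Monotone (equidistant n) := fun i j h => by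
  simpa [equidistant] using h

/-- The non-strategic neighbors of an agent inside the undisturbed region. -/
theorem Undisturbed.abs_sub_le_one_iff {x : Fin n → ℝ} {lo hi : ℕ} (h : Undisturbed x lo hi)
    {i : Fin n} (h1 : lo + 1 ≤ i.val) (h2 : i.val + 1 ≤ hi) (k : Fin n) :
    |x i - x k| ≤ 1 ↔ k.val + 1 = i.val ∨ k = i ∨ k.val = i.val + 1 := by
  have hi' := h.eq i (by omega) (by omega)
  have h1' : (lo : ℝ) + 1 ≤ i.val := by exact_mod_cast h1
  have h2' : (i.val : ℝ) + 1 ≤ hi := by exact_mod_cast h2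
  rw [hi', Fin.ext_iff]
  rcases lt_or_ge k.val lo with hk | hk
  · have := h.lt k hk
    constructor
    · intro h; linarith [(abs_le.1 h).2]
    · intro h; omega
  rcases lt_or_ge hi k.val with hk' | hk'
  · have := h.gt k hk'
    constructor
    · intro h; linarith [(abs_le.1 h).1]
    · intro h; omega
  rw [h.eq k hk hk', abs_le]
  constructor
  · rintro ⟨h3, h4⟩
    have h3 : (k.val : ℝ) ≤ i.val + 1 := by linarith
    have h4 : (i.val : ℝ) ≤ k.val + 1 := by linarith
    norm_cast at h3 h4
    omega
  · intro h5
    have h3 : k.val ≤ i.val + 1 := by omega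
    have h4 : i.val ≤ k.val + 1 := by omega
    have h3 : (k.val : ℝ) ≤ i.val + 1 := by exact_mod_cast h3
    have h4 : (i.val : ℝ) ≤ k.val + 1 := by exact_mod_cast h4
    constructor <;> linarith

theorem sum_neighbors_sumElim (x : N → ℝ) (u : S → ℝ) (i : N) (c : ℝ) :
    ∑ j ∈ neighbors (Sum.elim x u) (Sum.inl i), (Sum.elim x u j - c) =
      ∑ k with |x i - x k| ≤ 1, (x k - c) + ∑ s with |x i - u s| ≤ 1, (u s - c) := by
  rw [neighbors, Finset.sum_filter, Fintype.sum_sum_type, Finset.sum_filter, Finset.sum_filter]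
  rfl

theorem Undisturbed.sum_neighbors {x : Fin n → ℝ} {lo hi : ℕ} (h : Undisturbed x lo hi)
    (hn : hi < n) {i : Fin n} (h1 : lo + 1 ≤ i.val) (h2 : i.val + 1 ≤ hi) :
    ∑ k with |x i - x k| ≤ 1, (x k - i.val) = 0 := by
  classical
  have : (Finset.univ.filter fun k => |x i - x k| ≤ 1) =
      {(⟨i.val - 1, by omega⟩ : Fin n), i, ⟨i.val + 1, by omega⟩} := by
    ext k
    rw [Finset.mem_filter, h.abs_sub_le_one_iff h1 h2]
    simp only [Finset.mem_univ, true_and, Finset.mem_insert, Finset.mem_singleton, Fin.ext_iff]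
    omega
  rw [this, Finset.sum_insert, Finset.sum_insert, Finset.sum_singleton,
    h.eq _ (by simp only; omega) (by simp only; omega), h.eq i (by omega) (by omega),
    h.eq _ (by simp only; omega) (by simp only; omega)]
  · simp only
    rw [Nat.cast_sub (by omega)]
    push_cast
    ring
  · simp [Fin.ext_iff]
  · simp only [Finset.mem_insert, Finset.mem_singleton, Fin.ext_iff]
    omega

/-- Inside, the two neighbors balance. An agent left of `lo'` has opinion at most `lo' - 1`, so it
sees nothing above `lo'` and is itself strictly below; hence its mean stays below, whatever the
strategic agents do there. The right side is symmetric. -/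
theorem Undisturbed.step {x : Fin n → ℝ} {u : S → ℝ} {lo hi lo' hi' : ℕ}
    (h : Undisturbed x lo hi) (hn : hi < n) (hlo : lo + 1 ≤ lo') (hle : lo' ≤ hi')
    (hhi : hi' + 1 ≤ hi) (hf : ∀ i : Fin n, lo' ≤ i.val → i.val ≤ hi' → ∀ s, 1 < |x i - u s|) :
    Undisturbed (step x u) lo' hi' where
  eq i h1 h2 := by
    have hs := sum_neighbors_sumElim x u i i.val
    rw [h.sum_neighbors hn (by omega) (by omega), zero_add,
      Finset.filter_false_of_mem fun s _ => not_le.2 (hf i h1 h2 s), Finset.sum_empty] at hs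
    exact le_antisymm (step_le_of_sum_nonpos hs.le) (le_step_of_sum_nonneg hs.ge)
  lt i hlt := by
    have hxi : x i ≤ lo' - 1 := by
      have : (lo : ℝ) + 1 ≤ lo' := by exact_mod_cast hlo
      rcases lt_or_ge i.val lo with h1 | h1
      · linarith [h.lt i h1]
      · rw [h.eq i h1 (by omega)]
        have : (i.val : ℝ) + 1 ≤ lo' := by exact_mod_cast hlt
        linarith
    refine step_lt_of_sum_neg (Finset.sum_neg' (fun j hj => ?_)
      ⟨Sum.inl i, self_mem_neighbors _ _, ?_⟩)
    · have := (abs_le.1 (mem_neighbors.1 hj)).1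
      rw [Sum.elim_inl] at this
      linarith
    · rw [Sum.elim_inl]; linarith
  gt i hgt := by
    have hxi : (hi' : ℝ) + 1 ≤ x i := by
      have : (hi' : ℝ) + 1 ≤ hi := by exact_mod_cast hhi
      rcases lt_or_ge hi i.val with h1 | h1
      · linarith [h.gt i h1]
      · rw [h.eq i (by omega) h1]
        exact_mod_cast hgt
    refine lt_step_of_sum_pos (Finset.sum_pos' (fun j hj => ?_)
      ⟨Sum.inl i, self_mem_neighbors _ _, ?_⟩)
    · have := (abs_le.1 (mem_neighbors.1 hj)).2
      rw [Sum.elim_inl] at this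
      linarith
    · rw [Sum.elim_inl]; linarith

/-! ### Cutting the chain -/

/-- A strategic agent halfway between the undisturbed agents `p` and `p + 1` pulls them
together. -/
theorem Undisturbed.step_pair {x : Fin n → ℝ} {lo hi p : ℕ} (h : Undisturbed x lo hi)
    (hn : hi < n) (h1 : lo + 1 ≤ p) (h2 : p + 2 ≤ hi) :
    (p : ℝ) < HK.step x (fun _ : Fin 1 => (p : ℝ) + 1 / 2) ⟨p, by omega⟩ ∧
      HK.step x (fun _ : Fin 1 => (p : ℝ) + 1 / 2) ⟨p + 1, by omega⟩ < (p : ℝ) + 1 := by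
  constructor
  · apply lt_step_of_sum_pos
    have := h.sum_neighbors hn (i := ⟨p, by omega⟩) h1 (by simp only; omega)
    rw [sum_neighbors_sumElim, this, h.eq _ (by simp only; omega) (by simp only; omega),
      Finset.filter_true_of_mem]
    · simp
    · intro _ _; rw [abs_le]; constructor <;> simp only <;> linarith
  · apply step_lt_of_sum_neg
    have := h.sum_neighbors hn (i := ⟨p + 1, by omega⟩) (by simp only; omega) (by simp only; omega)
    simp only [Nat.cast_add, Nat.cast_one] at this
    rw [sum_neighbors_sumElim, this, h.eq _ (by simp only; omega) (by simp only; omega),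
      Finset.filter_true_of_mem]
    · simp; norm_num
    · intro _ _; rw [abs_le]; push_cast; constructor <;> linarith

/-- A gap before agent `c` together with position bounds for the two sides. -/
structure IsCut (x : Fin n → ℝ) (c : ℕ) : Prop where
  gap : IsGap x c
  le : ∀ i : Fin n, i.val < c → x i ≤ c
  ge : ∀ i : Fin n, c ≤ i.val → (c : ℝ) - 1 ≤ x i

/-- The position bounds persist for the same reason as the gap. They later bound the spread of a
block by its number of agents, and confine all opinions to `[-1, ∞)`. -/
theorem IsCut.step {x : Fin n → ℝ} {u : S → ℝ} {c : ℕ} (hcn : c ≤ n) (hx : Monotone x)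
    (hc : IsCut x c) (hf : ∀ i : Fin n, i.val + 1 = c ∨ i.val = c → ∀ s, 1 < |x i - u s|) :
    IsCut (step x u) c where
  gap := hc.gap.step hx hf
  le _ hi := step_le_of_isGap hcn hx hc.gap (fun i h => hf i (.inl h)) hc.le hi
  ge _ hi := le_step_of_isGap hx hc.gap (fun i h => hf i (.inr h)) hc.ge hi

theorem isCut_of_lt {x : Fin n → ℝ} (hx : Monotone x) {c : ℕ} (h0 : 0 < c) (hcn : c < n)
    (hgap : 1 < x ⟨c, hcn⟩ - x ⟨c - 1, by omega⟩) (hle : x ⟨c - 1, by omega⟩ ≤ c)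
    (hge : (c : ℝ) - 1 ≤ x ⟨c, hcn⟩) : IsCut x c := by
  have h1 : ∀ i : Fin n, i.val < c → x i ≤ x ⟨c - 1, by omega⟩ := fun i hi =>
    hx (by rw [Fin.le_def]; simp only; omega)
  have h2 : ∀ i : Fin n, c ≤ i.val → x ⟨c, hcn⟩ ≤ x i := fun i hi => hx hi
  exact ⟨fun i j hi hj => by linarith [h1 i hi, h2 j hj], fun i hi => (h1 i hi).trans hle,
    fun i hi => hge.trans (h2 i hi)⟩

/-- Effect of a strategic agent halfway between the undisturbed agents `p` and `p + 1`. -/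
theorem Undisturbed.isCut_step {x : Fin n → ℝ} (hx : Monotone x) {lo hi p : ℕ}
    (h : Undisturbed x lo hi) (hn : hi < n) (h1 : lo + 2 ≤ p) (h2 : p + 3 ≤ hi) :
    Undisturbed (HK.step x fun _ : Fin 1 => (p : ℝ) + 1 / 2) (lo + 1) (p - 1) ∧
    Undisturbed (HK.step x fun _ : Fin 1 => (p : ℝ) + 1 / 2) (p + 2) (hi - 1) ∧
    IsCut (HK.step x fun _ : Fin 1 => (p : ℝ) + 1 / 2) p ∧
    IsCut (HK.step x fun _ : Fin 1 => (p : ℝ) + 1 / 2) (p + 2) := by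
  obtain ⟨hp, hp1⟩ := h.step_pair hn (p := p) (by omega) (by omega)
  have hL : Undisturbed (HK.step x fun _ : Fin 1 => (p : ℝ) + 1 / 2) (lo + 1) (p - 1) := by
    refine h.step hn le_rfl (by omega) (by omega) fun i h3 h4 _ => ?_
    rw [h.eq i (by omega) (by omega), abs_sub_comm]
    have : (i.val : ℝ) + 1 ≤ p := by exact_mod_cast (by omega : i.val + 1 ≤ p)
    exact lt_of_lt_of_le (by linarith) (le_abs_self _)
  have hR : Undisturbed (HK.step x fun _ : Fin 1 => (p : ℝ) + 1 / 2) (p + 2) (hi - 1) := by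
    refine h.step hn (by omega) (by omega) (by omega) fun i h3 h4 _ => ?_
    rw [h.eq i (by omega) (by omega)]
    have : (p : ℝ) + 2 ≤ i.val := by exact_mod_cast h3
    exact lt_of_lt_of_le (by linarith) (le_abs_self _)
  have hm := monotone_step (fun _ : Fin 1 => (p : ℝ) + 1 / 2) hx
  -- Agents `p - 1` and `p + 2` keep their places while `p` and `p + 1` move inwards, so both outer
  -- distances exceed 1.
  have e1 := hL.eq ⟨p - 1, by omega⟩ (by simp only; omega) le_rfl
  have e2 := hR.eq ⟨p + 2, by omega⟩ le_rfl (by simp only; omega)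
  have hp1' : HK.step x (fun _ : Fin 1 => (p : ℝ) + 1 / 2) ⟨p + 2 - 1, by omega⟩ < (p : ℝ) + 1 := hp1
  simp only [Nat.cast_pred (show 0 < p by omega)] at e1
  push_cast at e2
  refine ⟨hL, hR, isCut_of_lt hm (by omega) (by omega) (by linarith) (by linarith) (by linarith),
    isCut_of_lt hm (by omega) (by omega) (by linarith) ?_ ?_⟩ <;> push_cast <;> linarith

/-- A strategic agent inside the undisturbed region does not affect the cuts outside of it. -/
theorem Undisturbed.isCut_step_of_isCut {x : Fin n → ℝ} (hx : Monotone x) {lo hi p c : ℕ}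
    (h : Undisturbed x lo hi) (hn : hi < n) (h1 : lo + 2 ≤ p) (h2 : p + 3 ≤ hi)
    (hc : IsCut x c) (hcn : c ≤ n) (hco : c ≤ lo ∨ hi < c) :
    IsCut (HK.step x fun _ : Fin 1 => (p : ℝ) + 1 / 2) c := by
  refine hc.step hcn hx fun i hi' _ => ?_
  have h1' : (lo : ℝ) + 2 ≤ p := by exact_mod_cast h1
  have h2' : (p : ℝ) + 3 ≤ hi := by exact_mod_cast h2
  rcases hco with hco | hco
  · have : x i ≤ lo := by
      refine (hx (show i ≤ ⟨lo, by omega⟩ by rw [Fin.le_def]; simp only; omega)).trans ?_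
      rw [h.eq _ le_rfl (by simp only; omega)]
    rw [abs_sub_comm]
    exact lt_of_lt_of_le (by linarith) (le_abs_self _)
  · have : (hi : ℝ) ≤ x i := by
      refine le_trans ?_ (hx (show ⟨hi, by omega⟩ ≤ i by rw [Fin.le_def]; simp only; omega))
      rw [h.eq _ (by simp only; omega) le_rfl]
    exact lt_of_lt_of_le (by linarith) (le_abs_self _)

/-! ### Convergence time without control -/

theorem FrozenOn.converged {x : Fin n → ℝ} (h : FrozenOn x 0 n) : Converged x :=
  fun i j => h i j (Nat.zero_le _) i.2 (Nat.zero_le _) j.2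

theorem convergenceTime_le {x₀ : N → ℝ} {u : ℕ → S → ℝ} {t : ℕ} (h : Converged (opinions x₀ u t)) :
    convergenceTime x₀ u ≤ t :=
  iInf₂_le t h

theorem uncontrolledConvergenceTime_ne_top (n : ℕ) (hn : 0 < n) :
    uncontrolledConvergenceTime (equidistant n) ≠ ⊤ := by
  set u : ℕ → Fin 0 → ℝ := fun _ s => s.elim0
  -- The whole chain is one block with `L = n`; its spread is at most `n`, which is `2 n ^ 3` units
  -- of `1 / (2 n ^ 2)`.
  refine ne_top_of_le_ne_top (ENat.natCast_ne_top (0 + 2 * (2 * n ^ 3) + 1)) (convergenceTime_le ?_)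
  refine (frozenOn_of_spread_le (x := opinions (equidistant n) u) (u := u) (fun _ => rfl)
    (monotone_opinions u monotone_equidistant) (fun _ _ s => s.elim0) hn (2 * n ^ 3) 0 n 0 le_rfl
    (by simp) (isGap_zero _) (isGap_self _) ?_ _ le_rfl).converged
  intro i j _ _ _ _
  have h1 : ((2 * n ^ 3 : ℕ) : ℝ) * (1 / (2 * (n : ℝ) ^ 2)) = n := by
    have : (n : ℝ) ≠ 0 := by positivity
    push_cast
    field_simp
  rw [h1]
  have h2 : (j.val : ℝ) ≤ n := by exact_mod_cast j.2.le
  have h3 : (0 : ℝ) ≤ i.val := by positivity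
  change (j.val : ℝ) ≤ i.val + n
  linarith

theorem undisturbed_opinions (u : ℕ → Fin 0 → ℝ) (t : ℕ) (ht : 2 * t + 1 ≤ n) :
    Undisturbed (opinions (equidistant n) u t) t (n - 1 - t) := by
  induction t with
  | zero => exact undisturbed_equidistant
  | succ t ih =>
    exact (ih (by omega)).step (by omega) le_rfl (by omega) (by omega) fun _ _ _ s => s.elim0

theorem le_uncontrolledConvergenceTime (n : ℕ) :
    ((n / 2 : ℕ) : ℕ∞) ≤ uncontrolledConvergenceTime (equidistant n) := by
  refine le_iInf₂ fun t ht => ?_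
  by_contra! hlt
  have hlt : t < n / 2 := by exact_mod_cast hlt
  have h := undisturbed_opinions (n := n) (fun _ s => s.elim0) t (by omega)
  have h' := ht ⟨t, by omega⟩ ⟨t + 1, by omega⟩
  rw [h.eq _ le_rfl (by simp only; omega), h.eq _ (by simp only; omega) (by simp only; omega)] at h'
  norm_num at h'

/-! ### The cutting strategy -/

/-- The number of cuts made on each side when the chain is cut into blocks of `W` agents. -/
def cutCount (n W : ℕ) : ℕ := (n - 2) / (2 * W)

/-- At time `t` the strategic agent is placed halfway between agents `cutPos n W t` and
`cutPos n W t + 1`, alternately on the left and on the right side. -/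
def cutPos (n W t : ℕ) : ℕ :=
  if t % 2 = 0 then (t / 2 + 1) * W - 2 else n - (t / 2 + 1) * W

/-- The strategy that cuts the chain into blocks and then leaves it alone. -/
noncomputable def cutControl (n W t : ℕ) (_ : Fin 1) : ℝ :=
  if t < 2 * cutCount n W then (cutPos n W t : ℝ) + 1 / 2 else -3

theorem cutCount_mul_le {W s : ℕ} (hs : s < cutCount n W) : 2 * (s * W + W) + 2 ≤ n := by
  have h1 : (s + 1) * (2 * W) ≤ cutCount n W * (2 * W) := Nat.mul_le_mul_right _ hs
  have h2 : cutCount n W * (2 * W) ≤ n - 2 := Nat.div_mul_le_self _ _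
  have h3 : (s + 1) * (2 * W) = 2 * (s * W + W) := by ring
  have h4 : 0 < n - 2 := by
    by_contra! h
    have : cutCount n W = 0 := by
      rw [cutCount, Nat.le_zero.1 h, Nat.zero_div]
    omega
  omega

/-- The block left between the last left and the last right cut has at most `2 W + 1` agents. -/
theorem lt_cutCount_mul {W : ℕ} (hW : 0 < W) : n < 2 * (cutCount n W * W) + 2 * W + 2 := by
  have h1 : n - 2 < 2 * W * (cutCount n W + 1) := Nat.lt_mul_div_succ _ (by omega)
  have h2 : 2 * W * (cutCount n W + 1) = 2 * (cutCount n W * W) + 2 * W := by ring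
  omega

/-- A round is one left and one right cut. The left cut costs the undisturbed region one agent at
its right end; `6 ≤ W` leaves the margin that `Undisturbed.isCut_step` needs for the right cut.
Earlier cuts survive because the strategic agent acts out of sight of their border agents. -/
theorem cutControl_invariant {W : ℕ} (hW : 6 ≤ W) (s : ℕ) (hs : s ≤ cutCount n W) :
    (∀ k ≤ s, IsCut (opinions (equidistant n) (cutControl n W) (2 * s)) (k * W) ∧
      IsCut (opinions (equidistant n) (cutControl n W) (2 * s)) (n - k * W)) ∧
    (s < cutCount n W →
      Undisturbed (opinions (equidistant n) (cutControl n W) (2 * s)) (s * W + 1)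
        (n - 2 - s * W)) := by
  set x := opinions (equidistant n) (cutControl n W) with hx
  have hm : ∀ t, Monotone (x t) := monotone_opinions _ monotone_equidistant
  induction s with
  | zero =>
    refine ⟨fun k hk => ?_, fun _ => undisturbed_equidistant⟩
    obtain rfl : k = 0 := by omega
    rw [Nat.zero_mul, Nat.sub_zero]
    refine ⟨⟨isGap_zero _, fun i h => absurd h (Nat.not_lt_zero _), fun i _ => ?_⟩,
      ⟨isGap_self _, fun i _ => ?_, fun i h => absurd i.2 (not_lt.2 h)⟩⟩
    · change _ ≤ (i.val : ℝ)
      have : (0 : ℝ) ≤ i.val := by positivity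
      push_cast
      linarith
    · change (i.val : ℝ) ≤ n
      exact_mod_cast i.2.le
  | succ s ih =>
    obtain ⟨hcut, hund⟩ := ih (by omega)
    have hund := hund (by omega)
    have hsn := cutCount_mul_le (n := n) (W := W) (s := s) (by omega)
    have hsW : (s + 1) * W = s * W + W := Nat.succ_mul _ _
    have hx1 : x (2 * s + 1) =
        HK.step (x (2 * s)) fun _ : Fin 1 => (((s + 1) * W - 2 : ℕ) : ℝ) + 1 / 2 := by
      change HK.step (x (2 * s)) (cutControl n W (2 * s)) = _
      congr 1
      funext i
      simp only [cutControl, cutPos]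
      rw [if_pos (by omega), if_pos (by omega), show 2 * s / 2 = s by omega]
    have hx2 : x (2 * (s + 1)) =
        HK.step (x (2 * s + 1)) fun _ : Fin 1 => ((n - (s + 1) * W : ℕ) : ℝ) + 1 / 2 := by
      change HK.step (x (2 * s + 1)) (cutControl n W (2 * s + 1)) = _
      congr 1
      funext i
      simp only [cutControl, cutPos]
      rw [if_pos (by omega), if_neg (by omega), show (2 * s + 1) / 2 = s by omega]
    rw [hsW] at hx1 hx2
    -- Each placement opens two gaps; only the one bordering the remaining middle is recorded.
    obtain ⟨-, hu1, -, hc1⟩ := hund.isCut_step (hm _) (p := s * W + W - 2) (by omega) (by omega)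
      (by omega)
    rw [← hx1, show s * W + W - 2 + 2 = s * W + W by omega] at hc1 hu1
    obtain ⟨hu2, -, hc2, -⟩ := hu1.isCut_step (hm _) (p := n - (s * W + W)) (by omega) (by omega)
      (by omega)
    rw [← hx2] at hc2 hu2
    have hkeep1 : ∀ c ≤ n, (c ≤ s * W + 1 ∨ n - 2 - s * W < c) → IsCut (x (2 * s)) c →
        IsCut (x (2 * s + 1)) c := fun c hcn hco hc => by
      rw [hx1]
      exact hund.isCut_step_of_isCut (hm _) (by omega) (by omega) (by omega) hc hcn hco
    have hkeep2 : ∀ c ≤ n, (c ≤ s * W + W ∨ n - 2 - s * W - 1 < c) → IsCut (x (2 * s + 1)) c →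
        IsCut (x (2 * (s + 1))) c := fun c hcn hco hc => by
      rw [hx2]
      exact hu1.isCut_step_of_isCut (hm _) (by omega) (by omega) (by omega) hc hcn hco
    refine ⟨fun k hk => ?_, fun hlt => ?_⟩
    · rcases hk.lt_or_eq with hk | rfl
      · have hk : k ≤ s := by omega
        have hkW : k * W ≤ s * W := Nat.mul_le_mul_right _ hk
        exact ⟨hkeep2 _ (by omega) (by omega) (hkeep1 _ (by omega) (by omega) (hcut k hk).1),
          hkeep2 _ (by omega) (by omega) (hkeep1 _ (by omega) (by omega) (hcut k hk).2)⟩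
      · rw [hsW]
        exact ⟨hkeep2 _ (by omega) (by omega) hc1, hc2⟩
    · have := cutCount_mul_le hlt
      rw [hsW] at this ⊢
      exact hu2.mono (by omega) (by omega) (by omega)

/-- The trivial cut at 0 carries the bound `-1 ≤ x i`, so the resting position `-3` is invisible
forever. -/
theorem one_lt_abs_sub_cutControl {W : ℕ} (hW : 6 ≤ W) (t : ℕ) (i : Fin n) (s : Fin 1) :
    1 < |opinions (equidistant n) (cutControl n W) (2 * cutCount n W + t) i -
      cutControl n W (2 * cutCount n W + t) s| := by
  set x := opinions (equidistant n) (cutControl n W) with hx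
  have hm : ∀ t, Monotone (x t) := monotone_opinions _ monotone_equidistant
  have hcut : ∀ t, IsCut (x (2 * cutCount n W + t)) 0 := by
    intro t
    induction t with
    | zero => simpa using ((cutControl_invariant hW (cutCount n W) le_rfl).1 0 (Nat.zero_le _)).1
    | succ t ih =>
      change IsCut (HK.step (x (2 * cutCount n W + t)) (cutControl n W (2 * cutCount n W + t))) 0
      refine ih.step (Nat.zero_le _) (hm _) fun i _ s => ?_
      have := ih.ge i (Nat.zero_le _)
      rw [cutControl, if_neg (by omega)]
      push_cast at this
      exact lt_of_lt_of_le (by linarith) (le_abs_self _)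
  have := (hcut t).ge i (Nat.zero_le _)
  rw [cutControl, if_neg (by omega)]
  push_cast at this
  exact lt_of_lt_of_le (by linarith) (le_abs_self _)

/-! ### Assembling the blocks and choosing their length -/

/-- An upper bound for the number of steps that blocks of length `L` need to freeze. -/
def freezeTime (L : ℕ) : ℕ := 2 * (2 * L ^ 2 * (L + 1)) + 1

/-- The cuts at `a` and `b` confine the block to `[a - 1, b]`, a spread of at most `L + 1`, which is
`2 L ^ 2 (L + 1)` units of `1 / (2 L ^ 2)`. -/
theorem frozenOn_of_isCut {x : ℕ → Fin n → ℝ} {u : ℕ → S → ℝ}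
    (hx : ∀ t, x (t + 1) = step (x t) (u t)) (hm : ∀ t, Monotone (x t))
    (hf : ∀ t i s, 1 < |x t i - u t s|) {L a b : ℕ} (hL : 0 < L) (hbn : b ≤ n) (hbL : b ≤ a + L)
    (ha : IsCut (x 0) a) (hb : IsCut (x 0) b) : FrozenOn (x (freezeTime L)) a b := by
  refine frozenOn_of_spread_le hx hm hf hL (2 * L ^ 2 * (L + 1)) a b 0 hbn (by omega) ha.gap hb.gap
    ?_ _ (by rw [freezeTime]; omega)
  intro i j hai _ _ hjb
  have h1 : ((2 * L ^ 2 * (L + 1) : ℕ) : ℝ) * (1 / (2 * (L : ℝ) ^ 2)) = L + 1 := by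
    have : (L : ℝ) ≠ 0 := by positivity
    push_cast
    field_simp
  rw [h1]
  have h2 : (b : ℝ) ≤ a + L := by exact_mod_cast hbL
  linarith [ha.ge i hai, hb.le j hjb]

theorem optimalConvergenceTime_le {W : ℕ} (hW : 6 ≤ W) :
    optimalConvergenceTime (equidistant n) 1 ≤
      ((2 * cutCount n W + freezeTime (2 * W + 2) : ℕ) : ℕ∞) := by
  refine (iInf_le _ (cutControl n W)).trans (convergenceTime_le ?_)
  set m := cutCount n W with hmdef
  set x : ℕ → Fin n → ℝ := fun t => opinions (equidistant n) (cutControl n W) (2 * m + t) with hx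
  have hm : ∀ t, Monotone (x t) := fun t => monotone_opinions _ monotone_equidistant _
  have hstep : ∀ t, x (t + 1) = step (x t) (cutControl n W (2 * m + t)) := fun _ => rfl
  have hf := one_lt_abs_sub_cutControl (n := n) hW
  have hcut : ∀ k ≤ m, IsCut (x 0) (k * W) ∧ IsCut (x 0) (n - k * W) :=
    (cutControl_invariant hW m le_rfl).1
  have hgap : ∀ c, IsCut (x 0) c → IsGap (x (freezeTime (2 * W + 2))) c := fun c hc =>
    isGap_of_le hstep hm hf hc.gap (Nat.zero_le _)
  have hblock : ∀ a b, b ≤ n → b ≤ a + (2 * W + 2) → IsCut (x 0) a → IsCut (x 0) b →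
      FrozenOn (x (freezeTime (2 * W + 2))) a b := fun a b h1 h2 ha hb =>
    frozenOn_of_isCut hstep hm hf (by omega) h1 h2 ha hb
  have hleft : ∀ k ≤ m, FrozenOn (x (freezeTime (2 * W + 2))) 0 (k * W) := by
    intro k hk
    induction k with
    | zero => intro i j _ h; omega
    | succ k ih =>
      have h1 := cutCount_mul_le (n := n) (W := W) (s := k) hk
      have h2 : (k + 1) * W = k * W + W := Nat.succ_mul _ _
      exact (ih (by omega)).append (hblock _ _ (by omega) (by omega) (hcut k (by omega)).1
        (hcut (k + 1) hk).1) (hgap _ (hcut k (by omega)).1)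
  have hmid := lt_cutCount_mul (n := n) (W := W) (by omega)
  rw [← hmdef] at hmid
  -- Starts with the middle block, then adds the right blocks moving outwards, hence the index `m -
  -- k`.
  have hright : ∀ k ≤ m, FrozenOn (x (freezeTime (2 * W + 2))) 0 (n - (m - k) * W) := by
    intro k hk
    induction k with
    | zero =>
      exact (hleft m le_rfl).append (hblock _ _ (by omega) (by rw [Nat.sub_zero]; omega)
        (hcut m le_rfl).1 (hcut m le_rfl).2) (hgap _ (hcut m le_rfl).1)
    | succ k ih =>
      have h2 : (m - k) * W = (m - (k + 1)) * W + W := by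
        rw [← Nat.succ_mul]; congr 1; omega
      exact (ih (by omega)).append (hblock _ _ (by omega) (by omega) (hcut (m - k) (by omega)).2
        (hcut (m - (k + 1)) (by omega)).2) (hgap _ (hcut (m - k) (by omega)).2)
  have := hright m le_rfl
  rw [Nat.sub_self, Nat.zero_mul, Nat.sub_zero] at this
  exact this.converged

theorem exists_coe_eq {a : ℕ → ℕ∞} (h : ∀ n, 0 < n → a n ≠ ⊤) :
    ∀ n, 0 < n → a n = ((a n).toNat : ℕ∞) :=
  fun n hn => (ENat.natCast_toNat (h n hn)).symm

/-- With blocks of about `n ^ (1 / 4)` agents, all phases take `O(n ^ (3 / 4))` steps. -/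
theorem cutCount_add_freezeTime_le (hn : 0 < n) :
    ((2 * cutCount n (⌈(n : ℝ) ^ (1 / 4 : ℝ)⌉₊ + 6) +
      freezeTime (2 * (⌈(n : ℝ) ^ (1 / 4 : ℝ)⌉₊ + 6) + 2) : ℕ) : ℝ) ≤
      30000 * (n : ℝ) ^ (3 / 4 : ℝ) := by
  set r : ℝ := (n : ℝ) ^ (1 / 4 : ℝ) with hr
  have hn1 : (1 : ℝ) ≤ n := by exact_mod_cast hn
  have hr1 : 1 ≤ r := Real.one_le_rpow hn1 (by norm_num)
  have hr4 : r ^ 4 = n := by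
    rw [hr, ← Real.rpow_natCast, ← Real.rpow_mul (by linarith)]; norm_num
  have hr3 : (n : ℝ) ^ (3 / 4 : ℝ) = r ^ 3 := by
    rw [hr, ← Real.rpow_natCast, ← Real.rpow_mul (by linarith)]; norm_num
  rw [hr3]
  set W := ⌈r⌉₊ + 6 with hW
  have hWr : r ≤ W := by
    rw [hW]; push_cast; linarith [Nat.le_ceil r]
  have hWr' : (W : ℝ) ≤ 8 * r := by
    rw [hW]; push_cast; linarith [Nat.ceil_lt_add_one (show 0 ≤ r by linarith)]
  have hcount : 2 * (cutCount n W : ℝ) ≤ r ^ 3 := by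
    have h1 : cutCount n W * (2 * W) ≤ n := (Nat.div_mul_le_self _ _).trans (Nat.sub_le _ _)
    have h2 : (cutCount n W : ℝ) * (2 * W) ≤ n := by exact_mod_cast h1
    have h3 : 2 * (cutCount n W : ℝ) * r ≤ r ^ 3 * r := by
      calc 2 * (cutCount n W : ℝ) * r ≤ 2 * (cutCount n W : ℝ) * W := by gcongr
        _ ≤ r ^ 3 * r := by rw [← pow_succ, hr4]; linarith
    exact le_of_mul_le_mul_right h3 (by linarith)
  -- With `2 W + 2 ≤ 18 r` the bound is `4 * 18 ^ 2 * 19 * r ^ 3 + 1`, and `4 * 18 ^ 2 * 19 =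
  -- 24624`.
  have hfreeze : (freezeTime (2 * W + 2) : ℝ) ≤ 29999 * r ^ 3 := by
    have h1 : (2 * (W : ℝ) + 2) ≤ 18 * r := by linarith
    have h2 : (2 * (W : ℝ) + 2) + 1 ≤ 19 * r := by linarith
    have h3 : 1 ≤ r ^ 3 := one_le_pow₀ hr1
    have h4 : (2 * (W : ℝ) + 2) ^ 2 * ((2 * (W : ℝ) + 2) + 1) ≤ (18 * r) ^ 2 * (19 * r) := by
      gcongr
    rw [freezeTime]
    push_cast
    nlinarith
  push_cast
  linarith

end HK

theorem mainTheorem5 :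
    (∃ T : ℕ → ℕ,
      (∀ n : ℕ, 0 < n → HK.uncontrolledConvergenceTime (HK.equidistant n) = (T n : ℕ∞)) ∧
      (fun n : ℕ => (n : ℝ)) =O[atTop] (fun n : ℕ => (T n : ℝ))) ∧
    (∃ T : ℕ → ℕ,
      (∀ n : ℕ, 0 < n → HK.optimalConvergenceTime (HK.equidistant n) 1 = (T n : ℕ∞)) ∧
      (fun n : ℕ => (T n : ℝ)) =O[atTop] (fun n : ℕ => (n : ℝ) ^ (3 / 4 : ℝ))) := by
  -- Finiteness under control needs only some admissible block length; `W = 6` is the least.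
  refine ⟨⟨_, HK.exists_coe_eq HK.uncontrolledConvergenceTime_ne_top, ?_⟩,
    ⟨_, HK.exists_coe_eq fun n _ => ne_top_of_le_ne_top (ENat.natCast_ne_top _)
      (HK.optimalConvergenceTime_le (W := 6) le_rfl), ?_⟩⟩
  -- The constant 3 absorbs the rounding: `n ≤ 3 * (n / 2)` for `n ≥ 2`.
  · refine IsBigO.of_bound 3 ?_
    filter_upwards [eventually_ge_atTop 2] with n hn
    have h := ENat.toNat_le_toNat (HK.le_uncontrolledConvergenceTime n)
      (HK.uncontrolledConvergenceTime_ne_top n (by omega))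
    rw [ENat.toNat_natCast] at h
    rw [Real.norm_natCast, Real.norm_natCast]
    exact_mod_cast (by omega : n ≤ 3 * (HK.uncontrolledConvergenceTime (HK.equidistant n)).toNat)
  · refine IsBigO.of_bound 30000 ?_
    filter_upwards [eventually_gt_atTop 0] with n hn
    have h := ENat.toNat_le_toNat (HK.optimalConvergenceTime_le (n := n)
      (W := ⌈(n : ℝ) ^ (1 / 4 : ℝ)⌉₊ + 6) (by omega)) (ENat.natCast_ne_top _)
    rw [ENat.toNat_natCast] at h
    rw [Real.norm_natCast, Real.norm_of_nonneg (by positivity)]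
    exact (Nat.cast_le.2 h).trans (HK.cutCount_add_freezeTime_le hn)
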